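/- A dissociation set of a graph is a set of vertices that induces a subgraph of maximum degree at most $1$; a maximum dissociation set is a dissociation set of maximum cardinality. For trees $T_1,\dots,T_r$, let $S^*_{T_1,\dots,T_r}$ denote a tree that is the union of induced subtrees isomorphic to $T_1,\dots,T_r$, all having one vertex $c$ as a common leaf (a vertex of degree $1$ in each of these subtrees) and pairwise sharing no vertex other than $c$. Let $P_k$ be the path on $k$ vertices. Theorem 4.3. Let $m\ge 1$ be an integer. Every tree on $3m+1$ vertices has at most $3^{m-1}+1$ maximum dissociation sets, and for every $m\ge 1$ some tree on $3m+1$ vertices has exactly $3^{m-1}+1$ maximum dissociation sets. If $m\ge 2$, then a tree $T$ on $3m+1$ vertices has exactly $3^{m-1}+1$ maximum dissociation sets if and only if $T$ is a tree $S^*_{P_3,P_2,T_1,\dots,T_{m-1}}$ where each $T_i$ is isomorphic to $P_4$ or to $K_{1,3}$. -/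

import Mathlib

namespace SimpleGraph

/-- A set of vertices is a dissociation set if it induces a subgraph in which every vertex has
degree at most `1`. -/
def IsDissociationSet {V : Type*} (G : SimpleGraph V) (s : Set V) : Prop :=
  ∀ v : s, ((G.induce s).neighborSet v).encard ≤ 1

/-- A maximum dissociation set: a dissociation set of maximum cardinality. -/
structure IsMaximumDissociationSet {V : Type*} [Finite V] (G : SimpleGraph V) (s : Finset V) :
    Prop where
  isDissociationSet : G.IsDissociationSet (s : Set V)
  maximum : ∀ t : Finset V, G.IsDissociationSet (t : Set V) → t.card ≤ s.card

/-- The number of maximum dissociation sets of a finite graph. -/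
noncomputable def numMaximumDissociationSets {V : Type*} [Finite V] (G : SimpleGraph V) : ℕ :=
  {s : Finset V | G.IsMaximumDissociationSet s}.ncard

/-- A leaf is a vertex of degree `1`. -/
def IsLeafVertex {V : Type*} (G : SimpleGraph V) (v : V) : Prop :=
  (G.neighborSet v).encard = 1

/-- `G` consists of induced subgraphs isomorphic to the graphs `T i` with a common leaf `c`:
`c` is a leaf of every one of these subgraphs, any two of them share no vertex other than `c`,
and together they contain all vertices and all edges of `G`. When the `T i` are trees, this says
that `G` is a tree `S^*` of the family `T`. Every `T i` is given as its number of vertices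
together with a graph on that many vertices. -/
def IsSStar {V ι : Type*} (G : SimpleGraph V) (T : ι → Σ n : ℕ, SimpleGraph (Fin n)) : Prop :=
  ∃ (c : V) (f : ∀ i, (T i).2 ↪g G),
    (∀ i, ∃ l, (T i).2.IsLeafVertex l ∧ f i l = c) ∧
    (∀ i j, i ≠ j → Set.range (f i) ∩ Set.range (f j) = {c}) ∧
    (∀ v, ∃ i, v ∈ Set.range (f i)) ∧
    (∀ u v, G.Adj u v → ∃ i, u ∈ Set.range (f i) ∧ v ∈ Set.range (f i))

end SimpleGraph

namespace SimpleGraph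

variable {V W : Type*} {G : SimpleGraph V} {G' : SimpleGraph W}

/-! ### Dissociation sets as sets without paths on three vertices -/

/-! A dissociation set is the complement of a set that meets every path on three vertices. In a
forest the largest number `k` of disjoint such paths equals the least size of such a cover
(`IsDepth.exists_packing_cover`). Fix a packing of `k` paths: the minimum covers select exactly one
vertex from each of them, so the maximum dissociation sets correspond to the selections that are
covers, called transversals (`IsTightPacking.numMaximumDissociationSets_eq`).

On `3 * m + 1` vertices `k ≤ m`, and `k < m` leaves at most `3 ^ (m - 1)` selections. If `k = m`,
one vertex `v` lies outside the packing. It is adjacent to some path `P i`, and this leaves `f i` at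
most two values. Unwanted further edges restrict two coordinates to 3 of their 9 combinations, or
three to 9 of their 27, and the bound is `3 ^ (m - 1)` again. Otherwise, possibly after exchanging
`v` with the far end of `P i`, all other paths are attached to the neighbor of `v`: the tree is a
`starTree`. There `f i₀ = 0` leaves the other coordinates free and `f i₀ = 1` determines them,
whence `3 ^ (m - 1) + 1`.

The trees `starTree` are the required trees `S^*`: a path on three vertices together with the center
attached to it is a `P_4` or a `K_{1,3}`. -/

lemma isDissociationSet_iff {s : Set V} :
    G.IsDissociationSet s ↔
      ∀ a b c, a ∈ s → b ∈ s → c ∈ s → G.Adj a b → G.Adj b c → a = c := by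
  constructor
  · intro h a b c ha hb hc hab hbc
    have := Set.encard_le_one_iff.1 (h ⟨b, hb⟩) ⟨a, ha⟩ ⟨c, hc⟩ (by simpa using hab.symm)
      (by simpa using hbc)
    simpa using this
  · intro h b
    refine Set.encard_le_one_iff.2 fun a c ha hc => ?_
    have ha' : G.Adj b a := by simpa using ha
    exact Subtype.ext (h a b c a.2 b.2 c.2 ha'.symm (by simpa using hc))

lemma Iso.isDissociationSet_map (φ : G ≃g G') {s : Finset V}
    (h : G.IsDissociationSet (s : Set V)) :
    G'.IsDissociationSet (s.map φ.toEquiv.toEmbedding : Set W) := by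
  rw [isDissociationSet_iff] at h ⊢
  simp only [Finset.coe_map, Set.mem_image, Finset.mem_coe]
  rintro _ _ _ ⟨a, ha, rfl⟩ ⟨b, hb, rfl⟩ ⟨c, hc, rfl⟩ hab hbc
  rw [h a b c ha hb hc (φ.map_adj_iff.1 hab) (φ.map_adj_iff.1 hbc)]

lemma Iso.isMaximumDissociationSet_map [Finite V] [Finite W] (φ : G ≃g G') {s : Finset V}
    (h : G.IsMaximumDissociationSet s) :
    G'.IsMaximumDissociationSet (s.map φ.toEquiv.toEmbedding) where
  isDissociationSet := φ.isDissociationSet_map h.1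
  maximum t ht := by
    simpa using h.2 _ (φ.symm.isDissociationSet_map ht)

lemma Iso.numMaximumDissociationSets_le [Finite V] [Finite W] (φ : G ≃g G') :
    G.numMaximumDissociationSets ≤ G'.numMaximumDissociationSets :=
  Set.ncard_le_ncard_of_injOn (fun s => s.map φ.toEquiv.toEmbedding)
    (fun _ hs => φ.isMaximumDissociationSet_map hs)
    (Finset.map_injective _).injOn (Set.toFinite _)

lemma Iso.numMaximumDissociationSets_eq [Finite V] [Finite W] (φ : G ≃g G') :
    G.numMaximumDissociationSets = G'.numMaximumDissociationSets :=
  φ.numMaximumDissociationSets_le.antisymm φ.symm.numMaximumDissociationSets_le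

/-! ### Packings of paths on three vertices and covers -/

/-- A family of pairwise disjoint (not necessarily induced) paths on three vertices. -/
structure IsPathPacking {ι : Type*} (G : SimpleGraph V) (P : ι → Fin 3 → V) : Prop where
  inj : ∀ i j i' j', P i j = P i' j' → i = i' ∧ j = j'
  adj_zero_one : ∀ i, G.Adj (P i 0) (P i 1)
  adj_one_two : ∀ i, G.Adj (P i 1) (P i 2)

/-- A depth function of a forest: adjacent vertices are on consecutive levels, and every vertex
has at most one neighbor on the level above it. -/
structure IsDepth (G : SimpleGraph V) (d : V → ℕ) : Prop where
  adj : ∀ u v, G.Adj u v → d u = d v + 1 ∨ d v = d u + 1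
  unique : ∀ w x y, G.Adj w x → G.Adj w y → d w = d x + 1 → d w = d y + 1 → x = y

/-- Two neighbors of `w` closer to `r` would give two paths from `r` to `w`, with different
penultimate vertices. -/
lemma IsTree.isDepth_dist (h : G.IsTree) (r : V) : G.IsDepth (G.dist r) where
  adj u v huv := h.dist_eq_dist_add_one_of_adj r huv
  unique w x y hx hy hwx hwy := by
    obtain ⟨p, hp, hpl⟩ := h.connected.exists_path_of_dist r x
    obtain ⟨q, hq, hql⟩ := h.connected.exists_path_of_dist r y
    have hp' : (p.concat hx.symm).IsPath :=
      Walk.isPath_of_length_eq_dist _ (by simp [hpl, hwx])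
    have hq' : (q.concat hy.symm).IsPath :=
      Walk.isPath_of_length_eq_dist _ (by simp [hql, hwy])
    have := congrArg Walk.penultimate ((h.existsUnique_path r w).unique hp' hq')
    simpa using this

/-- In a forest, a path on three vertices whose top is as deep as possible contains a vertex that
is contained in all the paths on three vertices that it meets. -/
lemma IsDepth.exists_path {d : V → ℕ} (hd : G.IsDepth d) (S : Finset V)
    (hS : ∃ a ∈ S, ∃ b ∈ S, ∃ c ∈ S, G.Adj a b ∧ G.Adj b c ∧ a ≠ c) :
    ∃ a ∈ S, ∃ b ∈ S, ∃ c ∈ S, G.Adj a b ∧ G.Adj b c ∧ a ≠ c ∧ ∃ p,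
      ∀ x ∈ S, ∀ y ∈ S, ∀ z ∈ S, G.Adj x y → G.Adj y z → x ≠ z →
        (x = a ∨ x = b ∨ x = c ∨ y = a ∨ y = b ∨ y = c ∨ z = a ∨ z = b ∨ z = c) →
          p = x ∨ p = y ∨ p = z := by
  classical
  obtain ⟨a, ha, b, hb, c, hc, hab, hbc, hac⟩ := hS
  let Q := (S ×ˢ S ×ˢ S).filter fun t => G.Adj t.1 t.2.1 ∧ G.Adj t.2.1 t.2.2 ∧ t.1 ≠ t.2.2
  obtain ⟨⟨a, b, c⟩, ht, hmax⟩ := Q.exists_max_image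
    (fun t => min (d t.1) (min (d t.2.1) (d t.2.2))) ⟨(a, b, c), by simp [Q, *]⟩
  simp only [Q, Finset.mem_filter, Finset.mem_product] at ht hmax
  obtain ⟨⟨ha, hb, hc⟩, hab, hbc, hac⟩ := ht
  refine ⟨a, ha, b, hb, c, hc, hab, hbc, hac, ?_⟩
  have key : ∀ u v w, G.Adj u v → G.Adj v w → u ≠ w →
      (d u = d v + 1 ∧ d w = d v + 1) ∨ (d v = d u + 1 ∧ d w = d v + 1) ∨
        (d u = d v + 1 ∧ d v = d w + 1) := by
    intro u v w huv hvw huw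
    have h1 := hd.adj u v huv
    have h2 := hd.adj v w hvw
    have h3 := hd.unique v u w huv.symm hvw
    grind
  have hmax' : ∀ x ∈ S, ∀ y ∈ S, ∀ z ∈ S, G.Adj x y → G.Adj y z → x ≠ z →
      min (d x) (min (d y) (d z)) ≤ min (d a) (min (d b) (d c)) :=
    fun x hx y hy z hz h1 h2 h3 => hmax (x, y, z) ⟨⟨hx, hy, hz⟩, h1, h2, h3⟩
  -- A vertex of a path that is not its top has its parent on the path.
  have step : ∀ x y z, G.Adj x y → G.Adj y z → x ≠ z → ∀ q r, q = x ∨ q = y ∨ q = z →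
      min (d x) (min (d y) (d z)) < d q → G.Adj q r → d q = d r + 1 → r = x ∨ r = y ∨ r = z := by
    intro x y z hxy hyz hxz q r hq hlt hqr hdq
    have k := key x y z hxy hyz hxz
    have h1 := hd.unique x y r hxy
    have h2 := hd.unique y x r hxy.symm
    have h3 := hd.unique y z r hyz
    have h4 := hd.unique z y r hyz.symm
    rcases hq with rfl | rfl | rfl <;> rcases k with k | k | k <;> grind
  -- Here `p` is the top of `a, b, c`. A path that meets `a, b, c` has a top no deeper than `p`, so
  -- going up to `p` from the common vertex stays on it.
  have main : ∀ p, d p = min (d a) (min (d b) (d c)) →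
      (∀ q, q = a ∨ q = b ∨ q = c → q = p ∨ (G.Adj q p ∧ d q = d p + 1) ∨
        ∃ r, G.Adj q r ∧ G.Adj r p ∧ d q = d r + 1 ∧ d r = d p + 1) →
      ∀ x ∈ S, ∀ y ∈ S, ∀ z ∈ S, G.Adj x y → G.Adj y z → x ≠ z →
        (x = a ∨ x = b ∨ x = c ∨ y = a ∨ y = b ∨ y = c ∨ z = a ∨ z = b ∨ z = c) →
          p = x ∨ p = y ∨ p = z := by
    intro p hdp hp x hx y hy z hz hxy hyz hxz hmeet
    have hm := hmax' x hx y hy z hz hxy hyz hxz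
    have hs := step x y z hxy hyz hxz
    obtain ⟨q, hq, hq'⟩ : ∃ q, (q = a ∨ q = b ∨ q = c) ∧ (q = x ∨ q = y ∨ q = z) := by
      rcases hmeet with h | h | h | h | h | h | h | h | h
      exacts [⟨x, by simp [h]⟩, ⟨x, by simp [h]⟩, ⟨x, by simp [h]⟩, ⟨y, by simp [h]⟩,
        ⟨y, by simp [h]⟩, ⟨y, by simp [h]⟩, ⟨z, by simp [h]⟩, ⟨z, by simp [h]⟩, ⟨z, by simp [h]⟩]
    rcases hp q hq with rfl | ⟨h1, h2⟩ | ⟨r, h1, h2, h3, h4⟩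
    · exact hq'
    · exact hs q p hq' (by omega) h1 h2
    · exact hs r p (hs q r hq' (by omega) h1 h3) (by omega) h2 h4
  rcases key a b c hab hbc hac with h | h | h
  · refine ⟨b, main b (by omega) ?_⟩
    rintro q (rfl | rfl | rfl)
    exacts [Or.inr (Or.inl ⟨hab, h.1⟩), Or.inl rfl, Or.inr (Or.inl ⟨hbc.symm, h.2⟩)]
  · refine ⟨a, main a (by omega) ?_⟩
    rintro q (rfl | rfl | rfl)
    exacts [Or.inl rfl, Or.inr (Or.inl ⟨hab.symm, h.1⟩),
      Or.inr (Or.inr ⟨b, hbc.symm, hab.symm, h.2, h.1⟩)]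
  · refine ⟨c, main c (by omega) ?_⟩
    rintro q (rfl | rfl | rfl)
    exacts [Or.inr (Or.inr ⟨b, hab, hbc, h.1, h.2⟩), Or.inr (Or.inl ⟨hbc, h.2⟩), Or.inl rfl]

/-- Duality between packings and covers of paths on three vertices in a forest. -/
theorem IsDepth.exists_packing_cover {d : V → ℕ} (hd : G.IsDepth d) (S : Finset V) :
    ∃ (k : ℕ) (P : Fin k → Fin 3 → V) (C : Finset V), G.IsPathPacking P ∧ (∀ i j, P i j ∈ S) ∧
      C.card ≤ k ∧ ∀ a ∈ S, ∀ b ∈ S, ∀ c ∈ S, G.Adj a b → G.Adj b c → a ≠ c →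
        a ∈ C ∨ b ∈ C ∨ c ∈ C := by
  classical
  induction hn : S.card using Nat.strong_induction_on generalizing S with
  | _ n ih =>
  by_cases hS : ∃ a ∈ S, ∃ b ∈ S, ∃ c ∈ S, G.Adj a b ∧ G.Adj b c ∧ a ≠ c
  · obtain ⟨a, ha, b, hb, c, hc, hab, hbc, hac, p, hp⟩ := hd.exists_path S hS
    obtain ⟨k, P, C, hP, hPS, hC, hcov⟩ := ih (S \ {a, b, c}).card
      (hn ▸ Finset.card_lt_card ⟨Finset.sdiff_subset, fun h => by simpa using h ha⟩) _ rfl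
    refine ⟨k + 1, Fin.cons ![a, b, c] P, insert p C, ⟨?_, ?_, ?_⟩, ?_,
      (Finset.card_insert_le _ _).trans (by omega), ?_⟩
    · have h1 : ∀ j i' j', ![a, b, c] j ≠ P i' j' := by
        intro j i' j' h
        have := hPS i' j'
        rw [← h] at this
        fin_cases j <;> simp at this
      have h2 : ∀ j j', ![a, b, c] j = ![a, b, c] j' → j = j' := by
        intro j j'
        have := hab.ne
        have := hbc.ne
        fin_cases j <;> fin_cases j' <;> simp <;> grind
      intro i j i' j'
      refine Fin.cases ?_ (fun i => ?_) i <;> refine Fin.cases ?_ (fun i' => ?_) i' <;>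
        simp only [Fin.cons_zero, Fin.cons_succ]
      · exact fun h => ⟨trivial, h2 _ _ h⟩
      · exact fun h => (h1 _ _ _ h).elim
      · exact fun h => (h1 _ _ _ h.symm).elim
      · intro h
        have := hP.inj _ _ _ _ h
        exact ⟨congrArg _ this.1, this.2⟩
    · exact Fin.cases (by simpa) (by simpa using hP.adj_zero_one)
    · exact Fin.cases (by simpa) (by simpa using hP.adj_one_two)
    · refine Fin.cases (fun j => ?_) (fun i j => ?_)
      · fin_cases j <;> simpa
      · simpa using (Finset.mem_sdiff.1 (hPS i j)).1
    · intro x hx y hy z hz hxy hyz hxz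
      have h1 := hp x hx y hy z hz hxy hyz hxz
      have h2 := hcov x
      simp only [Finset.mem_sdiff, Finset.mem_insert, Finset.mem_singleton] at h2 ⊢
      -- Paths that meet `a, b, c` contain `p`; the others survive the deletion and are met by `C`.
      by_cases hm : x = a ∨ x = b ∨ x = c ∨ y = a ∨ y = b ∨ y = c ∨ z = a ∨ z = b ∨ z = c
      · rcases h1 hm with h | h | h <;> simp [h]
      · simp only [not_or] at hm
        obtain ⟨m1, m2, m3, m4, m5, m6, m7, m8, m9⟩ := hm
        rcases h2 ⟨hx, by simp [*]⟩ y ⟨hy, by simp [*]⟩ z ⟨hz, by simp [*]⟩ hxy hyz hxz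
          with h | h | h <;> simp [h]
  · push Not at hS
    exact ⟨0, Fin.elim0, ∅, ⟨fun i => i.elim0, fun i => i.elim0, fun i => i.elim0⟩,
      fun i => i.elim0, by simp, fun a ha b hb c hc h1 h2 h3 => (h3 (hS a ha b hb c hc h1 h2)).elim⟩


/-! ### Maximum dissociation sets as transversals of a packing -/

section Transversals

variable {V ι : Type*} {G : SimpleGraph V} {P : ι → Fin 3 → V}

/-- The vertex `v` is one of the vertices that `f` selects from the members of `P`. -/
def Covers (P : ι → Fin 3 → V) (f : ι → Fin 3) (v : V) : Prop := ∃ i, P i (f i) = v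

/-- The selections of one vertex from each member of `P` that meet every path on three vertices. -/
def transversals (G : SimpleGraph V) (P : ι → Fin 3 → V) : Set (ι → Fin 3) :=
  {f | ∀ a b c, G.Adj a b → G.Adj b c → a ≠ c → Covers P f a ∨ Covers P f b ∨ Covers P f c}

/-- A path packing with as many members as some cover of the paths on three vertices has
vertices. -/
structure IsTightPacking [Fintype V] [Fintype ι] (G : SimpleGraph V) (P : ι → Fin 3 → V) : Prop
    extends G.IsPathPacking P where
  exists_large : ∃ s : Finset V, G.IsDissociationSet (s : Set V) ∧
    Fintype.card V ≤ s.card + Fintype.card ι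

lemma IsPathPacking.covers_iff (hP : G.IsPathPacking P) {f : ι → Fin 3} {i : ι} {j : Fin 3} :
    Covers P f (P i j) ↔ f i = j := by
  constructor
  · rintro ⟨i', h⟩
    obtain ⟨rfl, h'⟩ := hP.inj _ _ _ _ h
    exact h'
  · rintro rfl
    exact ⟨i, rfl⟩

section Finite

variable [Fintype V]

open Classical in
/-- The complement of the set of vertices selected by `f`. -/
noncomputable def unselected (P : ι → Fin 3 → V) (f : ι → Fin 3) : Finset V :=
  Finset.univ.filter fun v => ¬ Covers P f v

lemma mem_unselected {f : ι → Fin 3} {v : V} : v ∈ unselected P f ↔ ¬ Covers P f v := by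
  simp [unselected]

lemma isDissociationSet_unselected {f : ι → Fin 3} :
    G.IsDissociationSet (unselected P f : Set V) ↔ f ∈ G.transversals P := by
  simp only [isDissociationSet_iff, Finset.mem_coe, mem_unselected, transversals,
    Set.mem_ofPred_eq]
  constructor <;> intro h a b c <;> have := h a b c <;> tauto

lemma IsPathPacking.card_unselected [Fintype ι] (hP : G.IsPathPacking P) (f : ι → Fin 3) :
    (unselected P f).card + Fintype.card ι = Fintype.card V := by
  classical
  have h : (unselected P f)ᶜ = Finset.univ.image fun i => P i (f i) := by
    ext v
    simp [mem_unselected, Covers]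
  have h2 : ((unselected P f)ᶜ).card = Fintype.card ι := by
    rw [h, Finset.card_image_of_injective _ fun i j hij => (hP.inj _ _ _ _ hij).1,
      Finset.card_univ]
  rw [← h2, Finset.card_add_card_compl]

lemma IsPathPacking.exists_subset_unselected (hP : G.IsPathPacking P) {s : Finset V}
    (hs : G.IsDissociationSet (s : Set V)) : ∃ f, s ⊆ unselected P f := by
  rw [isDissociationSet_iff] at hs
  have h : ∀ i, ∃ j, P i j ∉ s := by
    intro i
    by_contra! h
    have := hs _ _ _ (h 0) (h 1) (h 2) (hP.adj_zero_one i) (hP.adj_one_two i)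
    simpa using (hP.inj _ _ _ _ this).2
  choose f hf using h
  refine ⟨f, fun v hv => mem_unselected.2 ?_⟩
  rintro ⟨i, rfl⟩
  exact hf i hv

variable [Fintype ι]

/-- Every dissociation set misses a vertex of each path, so it lies in some `unselected P f`. All
these sets have the same size, which tightness says is attained. -/
lemma IsTightPacking.numMaximumDissociationSets_eq (hP : G.IsTightPacking P) :
    G.numMaximumDissociationSets = (G.transversals P).ncard := by
  have hP' := hP.toIsPathPacking
  have hinj : Function.Injective (unselected P) := by
    intro f g h
    funext i
    have := congrArg (P i (g i) ∈ ·) h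
    simp only [mem_unselected, eq_iff_iff, not_iff_not, hP'.covers_iff, iff_true] at this
    exact this
  rw [numMaximumDissociationSets, ← Set.ncard_image_of_injective _ hinj]
  congr 1
  ext s
  simp only [Set.mem_ofPred_eq, Set.mem_image]
  constructor
  · intro hs
    obtain ⟨f, hf⟩ := hP'.exists_subset_unselected hs.1
    obtain ⟨t, ht, htc⟩ := hP.exists_large
    have h1 := hs.2 t ht
    have h2 := hP'.card_unselected f
    have h3 := Finset.eq_of_subset_of_card_le hf (by omega)
    exact ⟨f, isDissociationSet_unselected.1 (h3 ▸ hs.1), h3.symm⟩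
  · rintro ⟨f, hf, rfl⟩
    refine ⟨isDissociationSet_unselected.2 hf, fun t ht => ?_⟩
    obtain ⟨g, hg⟩ := hP'.exists_subset_unselected ht
    have h1 := hP'.card_unselected f
    have h2 := hP'.card_unselected g
    have h3 := Finset.card_le_card hg
    omega

lemma IsTree.exists_isTightPacking {T : SimpleGraph V} (hT : T.IsTree) :
    ∃ (k : ℕ) (P : Fin k → Fin 3 → V), T.IsTightPacking P := by
  classical
  obtain ⟨r⟩ := hT.connected.nonempty
  obtain ⟨k, P, C, hP, -, hC, hcov⟩ := (hT.isDepth_dist r).exists_packing_cover Finset.univ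
  refine ⟨k, P, hP, Cᶜ, ?_, ?_⟩
  · rw [isDissociationSet_iff]
    intro a b c ha hb hc hab hbc
    by_contra hac
    simp only [Finset.coe_compl, Set.mem_compl_iff, Finset.mem_coe] at ha hb hc
    have := hcov a (by simp) b (by simp) c (by simp) hab hbc hac
    tauto
  · have := Finset.card_compl_add_card C
    simp only [Fintype.card_fin]
    omega

lemma IsPathPacking.three_mul_card_le (hP : G.IsPathPacking P) :
    3 * Fintype.card ι ≤ Fintype.card V := by
  have : Function.Injective fun x : ι × Fin 3 => P x.1 x.2 := fun x y h =>
    Prod.ext (hP.inj _ _ _ _ h).1 (hP.inj _ _ _ _ h).2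
  simpa [mul_comm] using Fintype.card_le_of_injective _ this

end Finite

/-! ### Counting transversals -/

/-- `φ` records the coordinates in `J`, and `R` lists the values it may take; the other coordinates
are free. -/
lemma ncard_le_mul_pow [Fintype ι] {α : Type*} (S : Set (ι → Fin 3)) (J : Finset ι)
    (φ : (ι → Fin 3) → α) (hφ : ∀ f g, φ f = φ g → ∀ i ∈ J, f i = g i) (R : Finset α)
    (hR : ∀ f ∈ S, φ f ∈ R) : S.ncard ≤ R.card * 3 ^ (Fintype.card ι - J.card) := by
  classical
  let Q : Finset (α × ({i // i ∉ J} → Fin 3)) := R ×ˢ Finset.univ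
  have hQ : ∀ f ∈ S, (φ f, fun i : {i // i ∉ J} => f i) ∈ (Q : Set _) := fun f hf => by
    simpa [Q] using hR f hf
  have h := Set.ncard_le_ncard_of_injOn _ hQ ?_ Q.finite_toSet
  · rw [Set.ncard_coe_finset, Finset.card_product] at h
    simpa [Fintype.card_subtype_compl] using h
  · intro f _ g _ h
    simp only [Prod.mk.injEq] at h
    funext i
    by_cases hi : i ∈ J
    · exact hφ f g h.1 i hi
    · exact congrFun h.2 ⟨i, hi⟩

lemma ncard_le_pow_of_card_le [Fintype ι] {α : Type*} {S : Set (ι → Fin 3)} {r : ℕ}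
    (J : Finset ι) (hJ : J.card = r + 1)
    (φ : (ι → Fin 3) → α) (hφ : ∀ f g, φ f = φ g → ∀ i ∈ J, f i = g i) (R : Finset α)
    (hR : ∀ f ∈ S, φ f ∈ R) (hRc : R.card ≤ 3 ^ r) : S.ncard ≤ 3 ^ (Fintype.card ι - 1) := by
  have h := ncard_le_mul_pow S J φ hφ R hR
  have hJ' := J.card_le_univ
  calc S.ncard ≤ 3 ^ r * 3 ^ (Fintype.card ι - J.card) := h.trans (Nat.mul_le_mul_right _ hRc)
    _ = 3 ^ (Fintype.card ι - 1) := by rw [← pow_add]; congr 1; omega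

/-- The constraint is a decidable relation so that the remaining count is a finite check. -/
lemma ncard_le_pow_of_pair [Fintype ι] {S : Set (ι → Fin 3)} {i j : ι} (hij : i ≠ j)
    (R : Fin 3 → Fin 3 → Prop) [∀ x y, Decidable (R x y)] (hR : ∀ f ∈ S, R (f i) (f j))
    (hRc : (Finset.univ.filter fun p : Fin 3 × Fin 3 => R p.1 p.2).card ≤ 3) :
    S.ncard ≤ 3 ^ (Fintype.card ι - 1) := by
  classical
  exact ncard_le_pow_of_card_le (r := 1) {i, j} (Finset.card_pair hij) (fun f => (f i, f j))
    (by simp) _ (fun f hf => by simpa using hR f hf) hRc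

lemma ncard_le_pow_of_triple [Fintype ι] {S : Set (ι → Fin 3)} {i j k : ι} (hij : i ≠ j)
    (hik : i ≠ k) (hjk : j ≠ k)
    (R : Fin 3 → Fin 3 → Fin 3 → Prop) [∀ x y z, Decidable (R x y z)]
    (hR : ∀ f ∈ S, R (f i) (f j) (f k))
    (hRc : (Finset.univ.filter fun p : Fin 3 × Fin 3 × Fin 3 => R p.1 p.2.1 p.2.2).card ≤ 9) :
    S.ncard ≤ 3 ^ (Fintype.card ι - 1) := by
  classical
  exact ncard_le_pow_of_card_le (r := 2) {i, j, k} (by simp [*]) (fun f => (f i, f j, f k))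
    (by simp) _ (fun f hf => by simpa using hR f hf) hRc

/-- Adjacency of positions in a path on three vertices. -/
abbrev Consecutive (a b : Fin 3) : Prop := a.val + 1 = b.val ∨ b.val + 1 = a.val

lemma IsPathPacking.adj (hP : G.IsPathPacking P) (i : ι) {a b : Fin 3} (h : Consecutive a b) :
    G.Adj (P i a) (P i b) := by
  have h1 := hP.adj_zero_one i
  have h2 := hP.adj_one_two i
  have h3 := h1.symm
  have h4 := h2.symm
  fin_cases a <;> fin_cases b <;> simp_all [Consecutive]

lemma IsPathPacking.covers_or (hP : G.IsPathPacking P) {f : ι → Fin 3}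
    (hf : f ∈ G.transversals P) {v : V} {i : ι} {a : Fin 3} (hv : G.Adj v (P i a))
    (hne : ∀ b, P i b ≠ v) : ∀ b, Consecutive a b → Covers P f v ∨ f i = a ∨ f i = b := by
  intro b hab
  have := hf v (P i a) (P i b) hv (hP.adj i hab) (hne b).symm
  simpa only [hP.covers_iff] using this

lemma IsPathPacking.eq_or_eq_of_adj (hP : G.IsPathPacking P) {f : ι → Fin 3}
    (hf : f ∈ G.transversals P) {i j : ι} (hij : i ≠ j) {a b : Fin 3}
    (h : G.Adj (P j b) (P i a)) : ∀ c, Consecutive a c → f j = b ∨ f i = a ∨ f i = c := by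
  have := hP.covers_or hf h fun c h => hij (hP.inj _ _ _ _ h).1
  simpa only [hP.covers_iff] using this

lemma IsPathPacking.eq_or_eq_of_outside (hP : G.IsPathPacking P) {f : ι → Fin 3}
    (hf : f ∈ G.transversals P) {v : V} (hv : ∀ i j, P i j ≠ v) {i : ι} {a : Fin 3}
    (h : G.Adj v (P i a)) : ∀ c, Consecutive a c → f i = a ∨ f i = c := by
  intro c hc
  rcases hP.covers_or hf h (hv i) c hc with ⟨j, hj⟩ | h
  · exact (hv _ _ hj).elim
  · exact h

variable {v : V}

lemma IsPathPacking.ncard_le_of_two_neighbors [Fintype ι] (hP : G.IsPathPacking P) (hv : ∀ i j, P i j ≠ v)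
    {i j : ι} (hij : i ≠ j) {a b : Fin 3} (hi : G.Adj v (P i a)) (hj : G.Adj v (P j b)) :
    (G.transversals P).ncard ≤ 3 ^ (Fintype.card ι - 1) := by
  refine ncard_le_pow_of_pair hij (fun x y => (x = a ∨ y = b) ∧
    (∀ c, Consecutive a c → x = a ∨ x = c) ∧ (∀ c, Consecutive b c → y = b ∨ y = c)) ?_ ?_
  · intro f hf
    refine ⟨?_, hP.eq_or_eq_of_outside hf hv hi, hP.eq_or_eq_of_outside hf hv hj⟩
    have := hf _ v _ hi.symm hj fun h => hij (hP.inj _ _ _ _ h).1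
    rw [hP.covers_iff, hP.covers_iff] at this
    rcases this with h | ⟨k, h⟩ | h
    · exact .inl h
    · exact (hv _ _ h).elim
    · exact .inr h
  · clear hi hj
    revert a b
    decide

lemma IsPathPacking.ncard_le_of_adj_center [Fintype ι] (hP : G.IsPathPacking P) (hv : ∀ i j, P i j ≠ v)
    {i : ι} (hi : G.Adj v (P i 1)) :
    (G.transversals P).ncard ≤ 3 ^ (Fintype.card ι - 1) := by
  refine ncard_le_pow_of_card_le (r := 0) {i} (by simp) (fun f => f i) (by simp) {1} ?_ (by simp)
  intro f hf
  have h := hP.eq_or_eq_of_outside hf hv hi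
  simp only [Finset.mem_singleton]
  generalize f i = x at h
  revert x
  decide

/-- What `v ~ P i 0` says about a transversal. -/
lemma IsPathPacking.eq_zero_or_eq_one (hP : G.IsPathPacking P) {f : ι → Fin 3}
    (hf : f ∈ G.transversals P) (hv : ∀ i j, P i j ≠ v) {i : ι} (hi : G.Adj v (P i 0)) :
    f i = 0 ∨ f i = 1 :=
  hP.eq_or_eq_of_outside hf hv hi 1 (by decide)

lemma IsPathPacking.eq_of_eq_one (hP : G.IsPathPacking P) {f : ι → Fin 3}
    (hf : f ∈ G.transversals P) (hv : ∀ i j, P i j ≠ v) {i j : ι} {a : Fin 3}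
    (hi : G.Adj v (P i 0)) (hj : G.Adj (P i 0) (P j a)) (h1 : f i = 1) : f j = a := by
  have := hf v _ _ hi hj (hv _ _).symm
  rw [hP.covers_iff, hP.covers_iff] at this
  rcases this with ⟨k, h⟩ | h | h
  · exact (hv _ _ h).elim
  · simp [h1] at h
  · exact h

lemma IsPathPacking.eq_of_eq_zero (hP : G.IsPathPacking P) {f : ι → Fin 3}
    (hf : f ∈ G.transversals P) {i j : ι} (hij : i ≠ j) {a b : Fin 3}
    (hb : b ≠ 0) (hj : G.Adj (P i b) (P j a)) (h0 : f i = 0) : f j = a := by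
  -- In `Fin 3` the term `3 - b` is `-b`, which swaps `1` and `2`.
  have h12 : ∀ b : Fin 3, b ≠ 0 → Consecutive b (3 - b) ∧ 3 - b ≠ 0 := by decide
  have := hP.eq_or_eq_of_adj hf hij hj.symm (3 - b) (h12 b hb).1
  rw [h0] at this
  simpa [hb, hb.symm, (h12 b hb).2.symm] using this

lemma IsPathPacking.ncard_le_of_adj_zero_of_adj [Fintype ι] (hP : G.IsPathPacking P)
    (hv : ∀ i j, P i j ≠ v) {i j k : ι} (hij : i ≠ j) (hik : i ≠ k) {a b c : Fin 3}
    (hi : G.Adj v (P i 0)) (hj : G.Adj (P i 0) (P j a)) (hc : c ≠ 0)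
    (hk : G.Adj (P i c) (P k b)) :
    (G.transversals P).ncard ≤ 3 ^ (Fintype.card ι - 1) := by
  have key : ∀ f ∈ G.transversals P, (f i = 0 ∧ f k = b) ∨ (f i = 1 ∧ f j = a) := by
    intro f hf
    rcases hP.eq_zero_or_eq_one hf hv hi with h | h
    · exact .inl ⟨h, hP.eq_of_eq_zero hf hik hc hk h⟩
    · exact .inr ⟨h, hP.eq_of_eq_one hf hv hi hj h⟩
  by_cases hjk : j = k
  · subst hjk
    refine ncard_le_pow_of_pair hij (fun x y => (x = 0 ∧ y = b) ∨ (x = 1 ∧ y = a)) key ?_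
    clear hj hk key
    revert a b
    decide
  · refine ncard_le_pow_of_triple hij hik hjk
      (fun x y z => (x = 0 ∧ z = b) ∨ (x = 1 ∧ y = a)) key ?_
    clear hj hk key
    revert a b
    decide

/-- With `f i = 0` there is one choice for `f j`, with `f i = 1` at most two. -/
lemma IsPathPacking.ncard_le_of_adj_two [Fintype ι] (hP : G.IsPathPacking P)
    (hv : ∀ i j, P i j ≠ v) {i j : ι} (hij : i ≠ j) {a : Fin 3}
    (hi : G.Adj v (P i 0)) (hj : G.Adj (P i 2) (P j a)) :
    (G.transversals P).ncard ≤ 3 ^ (Fintype.card ι - 1) := by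
  refine ncard_le_pow_of_pair hij (fun x y => (x = 0 ∧ y = a) ∨
    (x = 1 ∧ ∀ c, Consecutive a c → y = a ∨ y = c)) ?_ ?_
  · intro f hf
    rcases hP.eq_zero_or_eq_one hf hv hi with h | h
    · exact .inl ⟨h, hP.eq_of_eq_zero hf hij (by decide) hj h⟩
    · refine .inr ⟨h, fun c hc => ?_⟩
      have := hP.eq_or_eq_of_adj hf hij.symm hj c hc
      simpa [h] using this
  · clear hj
    revert a
    decide

/-- With `f i = 1` only `f k` is free, which gives 3 choices; with `f i = 0` the edge between the
paths of `j` and `k` leaves at most 6 of 9 pairs. -/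
lemma IsPathPacking.ncard_le_of_adj_adj [Fintype ι] (hP : G.IsPathPacking P)
    (hv : ∀ i j, P i j ≠ v) {i j k : ι} (hij : i ≠ j) (hik : i ≠ k) (hjk : j ≠ k)
    {a b c : Fin 3} (hi : G.Adj v (P i 0)) (hj : G.Adj (P i 0) (P j a))
    (hk : G.Adj (P j c) (P k b)) :
    (G.transversals P).ncard ≤ 3 ^ (Fintype.card ι - 1) := by
  have key : ∀ f ∈ G.transversals P,
      (f i = 0 ∧ (∀ d, Consecutive c d → f k = b ∨ f j = c ∨ f j = d) ∧
        ∀ d, Consecutive b d → f j = c ∨ f k = b ∨ f k = d) ∨ (f i = 1 ∧ f j = a) := by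
    intro f hf
    rcases hP.eq_zero_or_eq_one hf hv hi with h | h
    · exact .inl ⟨h, hP.eq_or_eq_of_adj hf hjk hk.symm, hP.eq_or_eq_of_adj hf hjk.symm hk⟩
    · exact .inr ⟨h, hP.eq_of_eq_one hf hv hi hj h⟩
  refine ncard_le_pow_of_triple hij hik hjk
    (fun x y z => (x = 0 ∧ (∀ d, Consecutive c d → z = b ∨ y = c ∨ y = d) ∧
        ∀ d, Consecutive b d → y = c ∨ z = b ∨ z = d) ∨ (x = 1 ∧ y = a)) key ?_
  clear hj hk key
  revert a b c
  decide +kernel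

end Transversals


/-! ### The extremal trees -/

section StarTree

variable {V ι : Type*}

/-- Auxiliary relation for `starTree`. -/
def starTreeRel (i₀ : ι) (pos : ι → Fin 3) : Option (ι × Fin 3) → Option (ι × Fin 3) → Prop
  | none, some x => x = (i₀, 0)
  | some x, some y =>
      (x.1 = y.1 ∧ x.2.val + 1 = y.2.val) ∨ (x = (i₀, 0) ∧ y.1 ≠ i₀ ∧ y.2 = pos y.1)
  | _, none => False

/-- The tree that consists of a path on three vertices for every index, whose vertices are
numbered by `Fin 3`, and one further vertex `none`, where the first vertex of the path of `i₀` is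
adjacent to `none` and to the vertex number `pos i` of the path of every other `i`. -/
def starTree (i₀ : ι) (pos : ι → Fin 3) : SimpleGraph (Option (ι × Fin 3)) :=
  SimpleGraph.fromRel (starTreeRel i₀ pos)

variable {i₀ : ι} {pos : ι → Fin 3}

lemma starTree_adj_none_some {x : ι × Fin 3} :
    (starTree i₀ pos).Adj none (some x) ↔ x = (i₀, 0) := by
  simp [starTree, starTreeRel]

lemma starTree_adj_some_none {x : ι × Fin 3} :
    (starTree i₀ pos).Adj (some x) none ↔ x = (i₀, 0) := by
  rw [adj_comm, starTree_adj_none_some]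

lemma starTree_adj_some_some {i j : ι} {a b : Fin 3} :
    (starTree i₀ pos).Adj (some (i, a)) (some (j, b)) ↔
      (i = j ∧ Consecutive a b) ∨ (i = i₀ ∧ a = 0 ∧ j ≠ i₀ ∧ b = pos j) ∨
        (j = i₀ ∧ b = 0 ∧ i ≠ i₀ ∧ a = pos i) := by
  simp only [starTree, fromRel_adj, starTreeRel, Consecutive]
  grind

lemma starTree_isPathPacking :
    (starTree i₀ pos).IsPathPacking fun i j => some (i, j) where
  inj i j i' j' h := by simpa using h
  adj_zero_one i := by simp [starTree_adj_some_some, Consecutive]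
  adj_one_two i := by simp [starTree_adj_some_some, Consecutive]

lemma starTree_connected : (starTree i₀ pos).Connected := by
  have h1 : ∀ i a b, (starTree i₀ pos).Reachable (some (i, a)) (some (i, b)) := by
    intro i
    have h : ∀ a, (starTree i₀ pos).Reachable (some (i, a)) (some (i, 1)) := by
      intro a
      fin_cases a
      · exact (starTree_isPathPacking.adj_zero_one i).reachable
      · exact Reachable.refl _
      · exact (starTree_isPathPacking.adj_one_two i).reachable.symm
    exact fun a b => (h a).trans (h b).symm
  rw [connected_iff_exists_forall_reachable]
  refine ⟨some (i₀, 0), ?_⟩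
  rintro (_ | ⟨i, a⟩)
  · exact (starTree_adj_some_none.2 rfl).reachable
  · by_cases hi : i = i₀
    · exact hi ▸ h1 _ _ _
    · refine Reachable.trans (Adj.reachable ?_) (h1 i (pos i) a)
      simp [starTree_adj_some_some, hi]

/-- The listed edges form a connected spanning subgraph, and a tree is minimal among connected
graphs, so there are no others. -/
theorem IsTree.nonempty_iso_starTree {T : SimpleGraph V} (hT : T.IsTree)
    (e : Option (ι × Fin 3) ≃ V) (h0 : T.Adj (e none) (e (some (i₀, 0))))
    (h1 : ∀ i, T.Adj (e (some (i, 0))) (e (some (i, 1))))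
    (h2 : ∀ i, T.Adj (e (some (i, 1))) (e (some (i, 2))))
    (hpos : ∀ i, i ≠ i₀ → T.Adj (e (some (i₀, 0))) (e (some (i, pos i)))) :
    Nonempty (starTree i₀ pos ≃g T) := by
  have hPP : (T.comap e).IsPathPacking fun i j => some (i, j) :=
    ⟨fun i j i' j' h => by simpa using h, h1, h2⟩
  have hle : starTree i₀ pos ≤ T.comap e := by
    rintro (_ | ⟨i, a⟩) (_ | ⟨j, b⟩) h
    · exact (h.ne rfl).elim
    · rw [starTree_adj_none_some] at h
      exact h ▸ h0
    · rw [starTree_adj_some_none] at h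
      exact h ▸ h0.symm
    · rcases starTree_adj_some_some.1 h with ⟨rfl, h'⟩ | ⟨rfl, rfl, h', rfl⟩ | ⟨rfl, rfl, h', rfl⟩
      · exact hPP.adj _ h'
      · exact hpos _ h'
      · exact (hpos _ h').symm
  have hT' : (T.comap e).IsTree := (Iso.comap e T).isTree_iff.2 hT
  have heq := (isTree_iff_minimal_connected.1 hT').eq_of_le starTree_connected hle
  exact ⟨heq ▸ Iso.comap e T⟩

/-- Deleting `(i₀, 0)` separates the paths, which suffices if it is selected. If not, `f i₀ = 1`,
and the paths from `none` through `(i₀, 0)` force every `pos i`. -/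
lemma mem_transversals_starTree {f : ι → Fin 3} :
    f ∈ (starTree i₀ pos).transversals (fun i j => some (i, j)) ↔
      f i₀ = 0 ∨ (f i₀ = 1 ∧ ∀ i, i ≠ i₀ → f i = pos i) := by
  have hP := starTree_isPathPacking (i₀ := i₀) (pos := pos)
  constructor
  · intro hf
    have hv : ∀ (i : ι) (j : Fin 3), some (i, j) ≠ none := by simp
    have h0 : (starTree i₀ pos).Adj none (some (i₀, 0)) := starTree_adj_none_some.2 rfl
    rcases hP.eq_zero_or_eq_one hf hv h0 with h | h
    · exact .inl h
    · refine .inr ⟨h, fun i hi => hP.eq_of_eq_one hf hv h0 ?_ h⟩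
      simp [starTree_adj_some_some, hi]
  · intro hf
    have hcov : ∀ i j, Covers (fun i (j : Fin 3) => some (i, j)) f (some (i, j)) ↔ f i = j :=
      fun i j => hP.covers_iff
    have hthree : ∀ a b c d : Fin 3, Consecutive a b → Consecutive b c → a ≠ c →
        d = a ∨ d = b ∨ d = c := by decide
    have hcons : ∀ a : Fin 3, Consecutive a 0 ∨ Consecutive 0 a → a = 1 := by decide
    rintro (_ | ⟨i, a⟩) (_ | ⟨j, b⟩) (_ | ⟨k, c⟩) hab hbc hac <;>
      simp only [starTree_adj_none_some, starTree_adj_some_none, starTree_adj_some_some,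
        SimpleGraph.irrefl, hcov] at hab hbc ⊢
    all_goals grind

variable [Fintype ι]

lemma starTree_isTightPacking : (starTree i₀ pos).IsTightPacking fun i j => some (i, j) where
  toIsPathPacking := starTree_isPathPacking
  exists_large := by
    refine ⟨unselected (fun i j => some (i, j)) (fun _ => 0), ?_, ?_⟩
    · exact isDissociationSet_unselected.2 (mem_transversals_starTree.2 (.inl rfl))
    · exact ((starTree_isPathPacking (i₀ := i₀) (pos := pos)).card_unselected _).ge

theorem numMaximumDissociationSets_starTree :
    (starTree i₀ pos).numMaximumDissociationSets = 3 ^ (Fintype.card ι - 1) + 1 := by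
  classical
  rw [starTree_isTightPacking.numMaximumDissociationSets_eq]
  have h : (starTree i₀ pos).transversals (fun i j => some (i, j)) =
      insert (Function.update pos i₀ 1)
        ((Fintype.piFinset fun i => if i = i₀ then {0} else Finset.univ : Finset (ι → Fin 3)) :
          Set (ι → Fin 3)) := by
    ext f
    rw [mem_transversals_starTree, Set.mem_insert_iff, Finset.mem_coe, Fintype.mem_piFinset,
      or_comm]
    refine or_congr ⟨fun h => ?_, fun h => ?_⟩ ⟨fun h i => ?_, fun h => ?_⟩
    · funext i
      by_cases hi : i = i₀
      · subst hi; simp [h.1]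
      · simp [hi, h.2 i hi]
    · subst h
      refine ⟨by simp, fun i hi => by simp [hi]⟩
    · split_ifs with hi
      · simp [hi, h]
      · simp
    · simpa using h i₀
  rw [h, Set.ncard_insert_of_notMem, Set.ncard_coe_finset, Fintype.card_piFinset]
  · congr 1
    rw [← Finset.mul_prod_erase _ _ (Finset.mem_univ i₀), Finset.prod_congr rfl
      (g := fun _ => 3) fun i hi => by simp [(Finset.mem_erase.1 hi).1]]
    simp
  · rw [Finset.mem_coe, Fintype.mem_piFinset]
    intro h
    simpa using h i₀

end StarTree

/-! ### The upper bound -/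

section Bound

variable {V ι : Type*} [Fintype V] [Fintype ι] {T : SimpleGraph V} {P : ι → Fin 3 → V}

lemma IsPathPacking.exists_equiv (hP : T.IsPathPacking P)
    (hV : Fintype.card V = 3 * Fintype.card ι + 1) {v : V} (hv : ∀ i j, P i j ≠ v) :
    ∃ e : Option (ι × Fin 3) ≃ V, e none = v ∧ ∀ i j, e (some (i, j)) = P i j := by
  let g : Option (ι × Fin 3) → V := fun x => x.elim v fun y => P y.1 y.2
  have hg : Function.Injective g := by
    rintro (_ | x) (_ | y) h
    · rfl
    · exact (hv _ _ h.symm).elim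
    · exact (hv _ _ h).elim
    · exact congrArg some (Prod.ext (hP.inj _ _ _ _ h).1 (hP.inj _ _ _ _ h).2)
  have hb : Function.Bijective g := by
    rw [Fintype.bijective_iff_injective_and_card]
    exact ⟨hg, by simp [hV, mul_comm]⟩
  exact ⟨Equiv.ofBijective g hb, rfl, fun i j => rfl⟩

lemma IsTree.nonempty_iso_starTree_of_packing (hT : T.IsTree) (hP : T.IsPathPacking P)
    (hV : Fintype.card V = 3 * Fintype.card ι + 1) {v : V} (hv : ∀ i j, P i j ≠ v) {i : ι}
    (hi : T.Adj v (P i 0)) (hout : ∀ b, b ≠ 0 → ∀ j, j ≠ i → ∀ a, ¬ T.Adj (P i b) (P j a))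
    (hlt : 3 ^ (Fintype.card ι - 1) < (T.transversals P).ncard) :
    ∃ pos, Nonempty (starTree i pos ≃g T) := by
  obtain ⟨e, he0, he⟩ := hP.exists_equiv hV hv
  have hall : ∀ j, j ≠ i → ∃ a, T.Adj (P i 0) (P j a) := by
    by_contra! hex
    obtain ⟨k, hki, hk⟩ := hex
    -- If the path of `k` is not attached to `P i 0`, a walk from `v` to it leaves `A`; any edge
    -- leaving `A` makes the count too small.
    let A : Set V := {x | x = v ∨ (∃ b, x = P i b) ∨
      ∃ j a c, T.Adj (P i 0) (P j a) ∧ x = P j c}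
    obtain ⟨w⟩ := hT.connected.preconnected v (P k 0)
    obtain ⟨d, -, hd1, hd2⟩ := w.exists_boundary_dart A (.inl rfl) (by
      rintro (h | ⟨b, h⟩ | ⟨j, a, c, hj, h⟩)
      · exact hv _ _ h
      · exact hki (hP.inj _ _ _ _ h).1
      · exact hk a ((hP.inj _ _ _ _ h).1 ▸ hj))
    obtain ⟨⟨x, y⟩, hxy⟩ := d
    simp only [A, Set.mem_ofPred_eq, not_or, not_exists, not_and] at hd1 hd2 hxy
    obtain ⟨z, rfl⟩ := e.surjective y
    obtain _ | ⟨l, b⟩ := z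
    · exact hd2.1 he0
    rw [he] at hxy hd2
    have hli : l ≠ i := fun h => hd2.2.1 b (h ▸ rfl)
    have hl : ∀ a, ¬ T.Adj (P i 0) (P l a) := fun a h => hd2.2.2 l a b h rfl
    have hside : ∀ c, ¬ T.Adj (P i c) (P l b) := by
      intro c
      by_cases hc : c = 0
      · exact hc ▸ hl b
      · exact hout c hc l hli b
    rcases hd1 with rfl | ⟨c, rfl⟩ | ⟨j, a, c, hj, rfl⟩
    · exact hlt.not_ge (hP.ncard_le_of_two_neighbors hv hli.symm hi hxy)
    · exact hside c hxy
    · by_cases hji : j = i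
      · exact hside c (hji ▸ hxy)
      · exact hlt.not_ge (hP.ncard_le_of_adj_adj hv (Ne.symm hji) hli.symm
          (fun h => hl a (h ▸ hj)) hi hj hxy)
  have hpos : ∀ j, ∃ a, j ≠ i → T.Adj (P i 0) (P j a) := by
    intro j
    by_cases hj : j = i
    · exact ⟨0, fun h => (h hj).elim⟩
    · exact (hall j hj).imp fun a h _ => h
  choose pos hpos using hpos
  refine ⟨pos, hT.nonempty_iso_starTree e ?_ ?_ ?_ ?_⟩
  · rwa [he0, he]
  · simpa only [he] using hP.adj_zero_one
  · simpa only [he] using hP.adj_one_two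
  · simpa only [he] using hpos

lemma IsTree.exists_iso_starTree_of_adj_zero (hT : T.IsTree) (hP : T.IsTightPacking P)
    (hV : Fintype.card V = 3 * Fintype.card ι + 1) {v : V} (hv : ∀ i j, P i j ≠ v) {i : ι}
    (hi : T.Adj v (P i 0))
    (hlt : 3 ^ (Fintype.card ι - 1) < T.numMaximumDissociationSets) :
    ∃ i₀ pos, Nonempty (starTree (ι := ι) i₀ pos ≃g T) := by
  classical
  have hlt' := hlt
  rw [hP.numMaximumDissociationSets_eq] at hlt'
  by_cases hout : ∀ b, b ≠ 0 → ∀ j, j ≠ i → ∀ a, ¬ T.Adj (P i b) (P j a)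
  · exact ⟨i, hT.nonempty_iso_starTree_of_packing hP.1 hV hv hi hout hlt'⟩
  push Not at hout
  obtain ⟨b, hb, j, hj, a, hba⟩ := hout
  have h2 : ∀ k, k ≠ i → ∀ c, ¬ T.Adj (P i 2) (P k c) := fun k hk c h =>
    hlt'.not_ge (hP.1.ncard_le_of_adj_two hv hk.symm hi h)
  have h0 : ∀ k, k ≠ i → ∀ c, ¬ T.Adj (P i 0) (P k c) := fun k hk c h =>
    hlt'.not_ge (hP.1.ncard_le_of_adj_zero_of_adj hv hk.symm hj.symm hi h hb hba)
  have h3 : ∀ k, k ≠ i → ∀ c, ¬ T.Adj v (P k c) := fun k hk c h =>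
    hlt'.not_ge (hP.1.ncard_le_of_two_neighbors hv hk.symm hi h)
  -- Only `P i 1` can have neighbors in other paths, so it becomes the center; `P i 2` is the new
  -- outside vertex. Tightness persists, as `exists_large` depends only on the number of paths.
  let Q : ι → Fin 3 → V := Function.update P i ![P i 1, P i 0, v]
  have hQi : Q i = ![P i 1, P i 0, v] := Function.update_self ..
  have hQ : ∀ k, k ≠ i → Q k = P k := fun k hk => Function.update_of_ne hk ..
  have hinj := hP.inj
  have hne : ∀ x y, P i x = P i y → x = y := fun x y h => (hinj _ _ _ _ h).2
  have hself : ∀ x k y, k ≠ i → Q i x ≠ P k y := by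
    intro x k y hk h
    rw [hQi] at h
    fin_cases x
    · exact hk (hinj _ _ _ _ h).1.symm
    · exact hk (hinj _ _ _ _ h).1.symm
    · exact hv _ _ h.symm
  have hQP : T.IsTightPacking Q := by
    refine ⟨⟨?_, ?_, ?_⟩, hP.exists_large⟩
    · intro k x l y h
      by_cases hk : k = i <;> by_cases hl : l = i
      · subst hk hl
        refine ⟨rfl, ?_⟩
        rw [hQi] at h
        fin_cases x <;> fin_cases y <;> first
          | rfl
          | exact (hv _ _ h).elim
          | exact (hv _ _ h.symm).elim
          | exact absurd (hne _ _ h) (by decide)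
      · subst hk
        exact (hself x l y hl (h.trans (by rw [hQ l hl]))).elim
      · subst hl
        exact (hself y k x hk (h.symm.trans (by rw [hQ k hk]))).elim
      · rw [hQ k hk, hQ l hl] at h
        exact hinj _ _ _ _ h
    · intro k
      by_cases hk : k = i
      · subst hk
        rw [hQi]
        exact (hP.adj_zero_one k).symm
      · rw [hQ k hk]
        exact hP.adj_zero_one k
    · intro k
      by_cases hk : k = i
      · subst hk
        rw [hQi]
        exact hi.symm
      · rw [hQ k hk]
        exact hP.adj_one_two k
  refine ⟨i, hT.nonempty_iso_starTree_of_packing hQP.1 hV (v := P i 2) ?_ (i := i) ?_ ?_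
    (hQP.numMaximumDissociationSets_eq ▸ hlt)⟩
  · intro k x h
    by_cases hk : k = i
    · subst hk
      rw [hQi] at h
      fin_cases x
      · exact absurd (hne _ _ h) (by decide)
      · exact absurd (hne _ _ h) (by decide)
      · exact hv _ _ h.symm
    · rw [hQ k hk] at h
      exact hk (hinj _ _ _ _ h).1
  · rw [hQi]
    exact (hP.adj_one_two i).symm
  · intro x hx k hk c
    rw [hQ k hk, hQi]
    fin_cases x
    · exact (hx rfl).elim
    · exact h0 k hk c
    · exact h3 k hk c

/-- A tree on `3 * m + 1` vertices with a tight packing of `m` paths that has more than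
`3 ^ (m - 1)` maximum dissociation sets is a `starTree`. -/
theorem IsTightPacking.exists_iso_starTree (hP : T.IsTightPacking P) (hT : T.IsTree) [Nonempty ι]
    (hV : Fintype.card V = 3 * Fintype.card ι + 1)
    (hlt : 3 ^ (Fintype.card ι - 1) < T.numMaximumDissociationSets) :
    ∃ i₀ pos, Nonempty (starTree (ι := ι) i₀ pos ≃g T) := by
  classical
  obtain ⟨v, hv⟩ : ∃ v, ∀ i j, P i j ≠ v := by
    by_contra! h
    have : Function.Surjective fun x : ι × Fin 3 => P x.1 x.2 := fun v => by
      obtain ⟨i, j, h⟩ := h v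
      exact ⟨(i, j), h⟩
    have := Fintype.card_le_of_surjective _ this
    simp [hV, mul_comm] at this
  obtain ⟨e, he0, he⟩ := hP.exists_equiv hV hv
  obtain ⟨i, a, hi⟩ : ∃ i a, T.Adj v (P i a) := by
    obtain ⟨j⟩ := ‹Nonempty ι›
    have : Nontrivial V := ⟨v, P j 0, (hv j 0).symm⟩
    obtain ⟨y, hy⟩ := hT.connected.preconnected.exists_adj_of_nontrivial v
    obtain ⟨z, rfl⟩ := e.surjective y
    obtain _ | ⟨i, a⟩ := z
    · exact (hy.ne he0.symm).elim
    · exact ⟨i, a, he i a ▸ hy⟩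
  fin_cases a
  · exact hT.exists_iso_starTree_of_adj_zero hP hV hv hi hlt
  · rw [hP.numMaximumDissociationSets_eq] at hlt
    exact (hlt.not_ge (hP.1.ncard_le_of_adj_center hv hi)).elim
  · have hQ : T.IsTightPacking fun i j => P i j.rev := by
      refine ⟨⟨fun i j i' j' h => ?_, fun i => (hP.adj_one_two i).symm,
        fun i => (hP.adj_zero_one i).symm⟩, hP.exists_large⟩
      have := hP.inj _ _ _ _ h
      exact ⟨this.1, Fin.rev_injective this.2⟩
    exact hT.exists_iso_starTree_of_adj_zero hQ hV (fun i j => hv i _) hi hlt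

theorem IsTree.exists_iso_starTree {m : ℕ} (hm : 1 ≤ m) (hT : T.IsTree)
    (hV : Fintype.card V = 3 * m + 1) (hlt : 3 ^ (m - 1) < T.numMaximumDissociationSets) :
    ∃ (i₀ : Fin m) (pos : Fin m → Fin 3), Nonempty (starTree i₀ pos ≃g T) := by
  obtain ⟨k, P, hP⟩ := hT.exists_isTightPacking
  have hk := hP.1.three_mul_card_le
  rw [Fintype.card_fin] at hk
  obtain rfl | hkm : k = m ∨ k ≤ m - 1 := by omega
  · have : Nonempty (Fin k) := ⟨⟨0, hm⟩⟩
    exact hP.exists_iso_starTree hT (by simpa using hV) (by simpa using hlt)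
  · refine (hlt.not_ge ?_).elim
    rw [hP.numMaximumDissociationSets_eq]
    refine (Set.ncard_le_ncard (Set.subset_univ _)).trans ?_
    rw [Set.ncard_univ, Nat.card_eq_fintype_card]
    simpa using Nat.pow_le_pow_right (by norm_num) hkm

end Bound


/-! ### Some `starTree` is a tree -/

section Existence

variable {ι : Type*} [Fintype ι] {i₀ : ι}

/-- Every edge joins a vertex other than the root `(i₀, 0)` to its parent, so a connected graph with
this few edges is a tree. -/
theorem starTree_isTree : (starTree i₀ fun _ => 0).IsTree := by
  classical
  have hconn := starTree_connected (i₀ := i₀) (pos := fun _ => 0)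
  let parent : Option (ι × Fin 3) → Option (ι × Fin 3)
    | none => some (i₀, 0)
    | some (_, 0) => some (i₀, 0)
    | some (i, 1) => some (i, 0)
    | some (i, 2) => some (i, 1)
  have hpar : ∀ x y, (starTree i₀ fun _ => 0).Adj x y →
      (x ≠ some (i₀, 0) ∧ parent x = y) ∨ (y ≠ some (i₀, 0) ∧ parent y = x) := by
    rintro (_ | ⟨i, a⟩) (_ | ⟨j, b⟩) h
    · exact (h.ne rfl).elim
    · rw [starTree_adj_none_some] at h
      simp [h, parent]
    · rw [starTree_adj_some_none] at h
      simp [h, parent]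
    · rw [starTree_adj_some_some] at h
      fin_cases a <;> fin_cases b <;> simp [Consecutive, parent] at h ⊢ <;> grind
  rw [isTree_iff_connected_and_card]
  refine ⟨hconn, le_antisymm ?_ hconn.card_vert_le_card_edgeSet_add_one⟩
  have hsub : (starTree i₀ fun _ => 0).edgeSet ⊆
      (fun x => s(x, parent x)) '' {x | x ≠ some (i₀, 0)} := by
    intro e
    induction e with
    | _ x y =>
      intro h
      rcases hpar x y h with ⟨h1, h2⟩ | ⟨h1, h2⟩
      · exact ⟨x, h1, by simp [h2]⟩
      · exact ⟨y, h1, by simp [h2, Sym2.eq_swap]⟩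
  have h1 := (Set.ncard_le_ncard hsub).trans (Set.ncard_image_le (Set.toFinite _))
  have h2 : {x : Option (ι × Fin 3) | x ≠ some (i₀, 0)}.ncard < Nat.card (Option (ι × Fin 3)) := by
    rw [← Set.ncard_univ]
    refine Set.ncard_lt_ncard ⟨Set.subset_univ _, fun h => ?_⟩
    exact h (Set.mem_univ (some (i₀, 0))) rfl
  rw [Nat.card_coe_set_eq]
  omega

end Existence

/-! ### The trees `S^*` -/

section SStar

variable {V W : Type*} {G : SimpleGraph V} {G' : SimpleGraph W}

lemma isLeafVertex_iff {v : V} : G.IsLeafVertex v ↔ ∃ w, ∀ x, G.Adj v x ↔ x = w := by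
  simp [IsLeafVertex, Set.encard_eq_one, Set.ext_iff]

lemma Iso.isLeafVertex (φ : G ≃g G') {v : V} (h : G.IsLeafVertex v) : G'.IsLeafVertex (φ v) := by
  rw [isLeafVertex_iff] at h ⊢
  obtain ⟨w, hw⟩ := h
  refine ⟨φ w, fun x => ?_⟩
  obtain ⟨x, rfl⟩ := φ.surjective x
  rw [φ.map_adj_iff, hw, φ.injective.eq_iff]

lemma IsSStar.of_iso {ι : Type*} {F : ι → Σ n : ℕ, SimpleGraph (Fin n)} (φ : G ≃g G')
    (h : G.IsSStar F) : G'.IsSStar F := by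
  obtain ⟨c, f, h1, h2, h3, h4⟩ := h
  have hr : ∀ i, Set.range (φ.toEmbedding.comp (f i)) = φ '' Set.range (f i) := fun i => by
    rw [← Set.range_comp]; rfl
  refine ⟨φ c, fun i => φ.toEmbedding.comp (f i), fun i => ?_, fun i j hij => ?_, fun v => ?_,
    fun u v huv => ?_⟩
  · obtain ⟨l, hl, rfl⟩ := h1 i
    exact ⟨l, hl, rfl⟩
  · rw [hr, hr, ← Set.image_inter φ.injective, h2 i j hij, Set.image_singleton]
  · obtain ⟨v, rfl⟩ := φ.surjective v
    obtain ⟨i, hi⟩ := h3 v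
    exact ⟨i, hr i ▸ Set.mem_image_of_mem _ hi⟩
  · obtain ⟨u, rfl⟩ := φ.surjective u
    obtain ⟨v, rfl⟩ := φ.surjective v
    obtain ⟨i, hu, hv⟩ := h4 u v (φ.map_adj_iff.1 huv)
    exact ⟨i, hr i ▸ Set.mem_image_of_mem _ hu, hr i ▸ Set.mem_image_of_mem _ hv⟩

/-- The tree on four vertices with the leaf `0` in which the other three vertices form a path and
the neighbor of `0` is the vertex number `p` of this path. -/
def leafedPath (p : Fin 3) : SimpleGraph (Fin 4) :=
  SimpleGraph.fromRel fun x y => (x = 0 ∧ y = p.succ) ∨ (x ≠ 0 ∧ x.val + 1 = y.val)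

instance (p : Fin 3) : DecidableRel (leafedPath p).Adj := fun x y =>
  inferInstanceAs (Decidable (x ≠ y ∧ (((x = 0 ∧ y = p.succ) ∨ (x ≠ 0 ∧ x.val + 1 = y.val)) ∨
    ((y = 0 ∧ x = p.succ) ∨ (y ≠ 0 ∧ y.val + 1 = x.val)))))

lemma isLeafVertex_leafedPath (p : Fin 3) : (leafedPath p).IsLeafVertex 0 := by
  rw [isLeafVertex_iff]
  revert p
  decide

/-- Attaching the leaf at an end of the path gives `P_4`, at its middle `K_{1,3}`. -/
lemma leafedPath_iso (p : Fin 3) : Nonempty (leafedPath p ≃g pathGraph 4) ∨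
    Nonempty (leafedPath p ≃g completeBipartiteGraph (Fin 1) (Fin 3)) := by
  fin_cases p
  · refine .inl ⟨⟨Equiv.refl _, ?_⟩⟩
    intro x y
    rw [pathGraph_adj]
    revert x y
    decide
  · refine .inr ⟨⟨⟨![.inr 0, .inr 1, .inl 0, .inr 2], Sum.elim ![2] ![0, 1, 3], ?_, ?_⟩, ?_⟩⟩
    · decide
    · decide
    · intro x y
      simp only [completeBipartiteGraph_adj]
      revert x y
      decide
  · refine .inl ⟨⟨⟨![0, 3, 2, 1], ![0, 3, 2, 1], ?_, ?_⟩, ?_⟩⟩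
    · decide
    · decide
    · intro x y
      rw [pathGraph_adj]
      revert x y
      decide

lemma leafedPath_adj_zero_succ :
    ∀ {p x : Fin 3}, (leafedPath p).Adj 0 x.succ ↔ x = p := by
  decide

lemma leafedPath_adj_succ_succ :
    ∀ {p x y : Fin 3}, (leafedPath p).Adj x.succ y.succ ↔ Consecutive x y := by
  decide

/-- The part of `starTree` that consists of the center and the path of one other index. -/
def leafedPathEmbedding {ι : Type*} {i₀ : ι} {pos : ι → Fin 3} {i : ι} (hi : i ≠ i₀) :
    leafedPath (pos i) ↪g starTree i₀ pos where
  toFun := Fin.cons (some (i₀, 0)) fun j => some (i, j)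
  inj' := by
    intro x y
    refine Fin.cases ?_ (fun x => ?_) x <;> refine Fin.cases ?_ (fun y => ?_) y <;>
      simp [hi, hi.symm]
  map_rel_iff' := by
    intro x y
    let g : Fin 4 → Option (ι × Fin 3) := Fin.cons (some (i₀, 0)) fun j => some (i, j)
    change (starTree i₀ pos).Adj (g x) (g y) ↔ _
    have hg0 : g 0 = some (i₀, 0) := rfl
    have hg : ∀ j : Fin 3, g j.succ = some (i, j) := fun _ => rfl
    refine Fin.cases ?_ (fun x => ?_) x <;> refine Fin.cases ?_ (fun y => ?_) y
    · simp
    · simp [hg0, hg, hi, hi.symm, starTree_adj_some_some, leafedPath_adj_zero_succ]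
    · rw [adj_comm, adj_comm (leafedPath _)]
      simp [hg0, hg, hi, hi.symm, starTree_adj_some_some, leafedPath_adj_zero_succ]
    · simp [hg, hi, starTree_adj_some_some, leafedPath_adj_succ_succ]

/-- The path of the distinguished index in `starTree`. -/
def pathGraphThreeEmbedding {ι : Type*} (i₀ : ι) (pos : ι → Fin 3) :
    pathGraph 3 ↪g starTree i₀ pos where
  toFun := fun j => some (i₀, j)
  inj' := fun x y => by simp
  map_rel_iff' := by
    intro x y
    change (starTree i₀ pos).Adj (some (i₀, x)) (some (i₀, y)) ↔ _
    simp [starTree_adj_some_some, pathGraph_adj, Consecutive]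

/-- The edge between the center of `starTree` and the vertex `none`. -/
def pathGraphTwoEmbedding {ι : Type*} (i₀ : ι) (pos : ι → Fin 3) :
    pathGraph 2 ↪g starTree i₀ pos where
  toFun := ![some (i₀, 0), none]
  inj' := fun x y => by fin_cases x <;> fin_cases y <;> simp
  map_rel_iff' := by
    intro x y
    change (starTree i₀ pos).Adj (![some (i₀, 0), none] x) (![some (i₀, 0), none] y) ↔ _
    fin_cases x <;> fin_cases y <;>
      simp [starTree_adj_some_none, starTree_adj_none_some, pathGraph_adj]

theorem starTree_isSStar {k : ℕ} (i₀ : Fin (k + 1)) (pos : Fin (k + 1) → Fin 3) :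
    (starTree i₀ pos).IsSStar (Sum.elim ![⟨3, pathGraph 3⟩, ⟨2, pathGraph 2⟩]
      fun i : Fin k => ⟨4, leafedPath (pos (i₀.succAbove i))⟩) := by
  let F : Fin 2 ⊕ Fin k → Σ n : ℕ, SimpleGraph (Fin n) :=
    Sum.elim ![⟨3, pathGraph 3⟩, ⟨2, pathGraph 2⟩]
      fun i : Fin k => ⟨4, leafedPath (pos (i₀.succAbove i))⟩
  let f : ∀ i, (F i).2 ↪g starTree i₀ pos
    | .inl 0 => pathGraphThreeEmbedding i₀ pos
    | .inl 1 => pathGraphTwoEmbedding i₀ pos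
    | .inr i => leafedPathEmbedding (i₀.succAbove_ne i)
  have hr0 : ∀ v, v ∈ Set.range (f (.inl 0)) ↔ ∃ j, v = some (i₀, j) := fun v =>
    exists_congr fun j => eq_comm
  have hr1 : ∀ v, v ∈ Set.range (f (.inl 1)) ↔ v = some (i₀, 0) ∨ v = none := by
    intro v
    constructor
    · rintro ⟨j, rfl⟩
      change Fin 2 at j
      fin_cases j
      exacts [.inl rfl, .inr rfl]
    · rintro (rfl | rfl)
      exacts [⟨(0 : Fin 2), rfl⟩, ⟨(1 : Fin 2), rfl⟩]
  have hr2 : ∀ i v, v ∈ Set.range (f (.inr i)) ↔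
      v = some (i₀, 0) ∨ ∃ j, v = some (i₀.succAbove i, j) := by
    intro i v
    constructor
    · rintro ⟨j, rfl⟩
      refine Fin.cases ?_ (fun j => ?_) (j : Fin 4)
      exacts [.inl rfl, .inr ⟨j, rfl⟩]
    · rintro (rfl | ⟨j, rfl⟩)
      exacts [⟨(0 : Fin 4), rfl⟩, ⟨(j.succ : Fin 4), rfl⟩]
  have hidx : ∀ i, i = i₀ ∨ ∃ j, i = i₀.succAbove j := by
    intro i
    by_cases hi : i = i₀
    · exact .inl hi
    · obtain ⟨j, hj⟩ := Fin.exists_succAbove_eq hi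
      exact .inr ⟨j, hj.symm⟩
  have htwo : ∀ i : Fin 2, i = 0 ∨ i = 1 := by decide
  have hleaf3 : (pathGraph 3).IsLeafVertex 0 := by
    simp only [isLeafVertex_iff, pathGraph_adj]
    decide
  have hleaf2 : (pathGraph 2).IsLeafVertex 0 := by
    simp only [isLeafVertex_iff, pathGraph_adj]
    decide
  have hc : ∀ l, some (i₀, 0) ∈ Set.range (f l)
    | .inl 0 => (hr0 _).2 ⟨0, rfl⟩
    | .inl 1 => (hr1 _).2 (.inl rfl)
    | .inr i => (hr2 i _).2 (.inl rfl)
  have hdisj : ∀ l l' v, v ∈ Set.range (f l) → v ∈ Set.range (f l') →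
      v = some (i₀, 0) ∨ l = l' := by
    have h01 : ∀ v, v ∈ Set.range (f (.inl 0)) → v ∈ Set.range (f (.inl 1)) →
        v = some (i₀, 0) := by
      intro v h h'
      obtain ⟨j, rfl⟩ := (hr0 _).1 h
      exact ((hr1 _).1 h').resolve_right (by simp)
    have h02 : ∀ i v, v ∈ Set.range (f (.inl 0)) → v ∈ Set.range (f (.inr i)) →
        v = some (i₀, 0) := by
      intro i v h h'
      obtain ⟨j, rfl⟩ := (hr0 _).1 h
      exact ((hr2 _ _).1 h').resolve_right (by simp [(i₀.succAbove_ne i).symm])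
    have h12 : ∀ i v, v ∈ Set.range (f (.inl 1)) → v ∈ Set.range (f (.inr i)) →
        v = some (i₀, 0) := by
      intro i v h h'
      obtain h | rfl := (hr1 _).1 h
      · exact h
      · exact ((hr2 _ _).1 h').resolve_right (by simp)
    rintro (i | i) (j | j) v h h'
    · obtain rfl | rfl : i = 0 ∨ i = 1 := htwo i
      · obtain rfl | rfl : j = 0 ∨ j = 1 := htwo j
        exacts [.inr rfl, .inl (h01 v h h')]
      · obtain rfl | rfl : j = 0 ∨ j = 1 := htwo j
        exacts [.inl (h01 v h' h), .inr rfl]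
    · obtain rfl | rfl : i = 0 ∨ i = 1 := htwo i
      exacts [.inl (h02 j v h h'), .inl (h12 j v h h')]
    · obtain rfl | rfl : j = 0 ∨ j = 1 := htwo j
      exacts [.inl (h02 i v h' h), .inl (h12 i v h' h)]
    · obtain h | ⟨a, rfl⟩ := (hr2 _ _).1 h
      · exact .inl h
      · obtain h' | ⟨b, h'⟩ := (hr2 _ _).1 h'
        · exact .inl h'
        · simp only [Option.some.injEq, Prod.mk.injEq, Fin.succAbove_right_inj] at h'
          exact .inr (congrArg _ h'.1)
  refine ⟨some (i₀, 0), f, ?_, fun i j hij => ?_, ?_, ?_⟩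
  · rintro (i | i)
    · obtain rfl | rfl : i = 0 ∨ i = 1 := htwo i
      exacts [⟨(0 : Fin 3), hleaf3, rfl⟩, ⟨(0 : Fin 2), hleaf2, rfl⟩]
    · exact ⟨(0 : Fin 4), isLeafVertex_leafedPath _, rfl⟩
  · ext v
    refine ⟨fun h => (hdisj i j v h.1 h.2).resolve_right hij, ?_⟩
    rintro rfl
    exact ⟨hc i, hc j⟩
  · rintro (_ | ⟨i, a⟩)
    · exact ⟨.inl 1, (hr1 _).2 (.inr rfl)⟩
    · rcases hidx i with rfl | ⟨j, rfl⟩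
      · exact ⟨.inl 0, (hr0 _).2 ⟨a, rfl⟩⟩
      · exact ⟨.inr j, (hr2 _ _).2 (.inr ⟨a, rfl⟩)⟩
  · have hwlog : ∀ i a j b, (i = j ∧ Consecutive a b) ∨
        (i = i₀ ∧ a = 0 ∧ j ≠ i₀ ∧ b = pos j) →
        ∃ l, some (i, a) ∈ Set.range (f l) ∧ some (j, b) ∈ Set.range (f l) := by
      rintro i a j b (⟨rfl, -⟩ | ⟨rfl, rfl, hj, -⟩)
      · rcases hidx i with rfl | ⟨l, rfl⟩
        · exact ⟨.inl 0, (hr0 _).2 ⟨a, rfl⟩, (hr0 _).2 ⟨b, rfl⟩⟩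
        · exact ⟨.inr l, (hr2 _ _).2 (.inr ⟨a, rfl⟩), (hr2 _ _).2 (.inr ⟨b, rfl⟩)⟩
      · rcases hidx j with rfl | ⟨l, rfl⟩
        · exact (hj rfl).elim
        · exact ⟨.inr l, (hr2 _ _).2 (.inl rfl), (hr2 _ _).2 (.inr ⟨b, rfl⟩)⟩
    rintro (_ | ⟨i, a⟩) (_ | ⟨j, b⟩) h
    · exact (h.ne rfl).elim
    · rw [starTree_adj_none_some] at h
      exact ⟨.inl 1, (hr1 _).2 (.inr rfl), (hr1 _).2 (.inl (congrArg some h))⟩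
    · rw [starTree_adj_some_none] at h
      exact ⟨.inl 1, (hr1 _).2 (.inl (congrArg some h)), (hr1 _).2 (.inr rfl)⟩
    · rcases starTree_adj_some_some.1 h with h | h | h
      · exact hwlog _ _ _ _ (.inl h)
      · exact hwlog _ _ _ _ (.inr h)
      · obtain ⟨l, h1, h2⟩ := hwlog _ _ _ _ (.inr h)
        exact ⟨l, h2, h1⟩

/-- A tree that is a path on four vertices or a star with three leaves consists of any of its
leaves and a path on three vertices. -/
lemma exists_path_of_isLeafVertex {l : V}
    (hG : Nonempty (G ≃g pathGraph 4) ∨ Nonempty (G ≃g completeBipartiteGraph (Fin 1) (Fin 3)))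
    (hl : G.IsLeafVertex l) : ∃ (g : Fin 3 → V) (p : Fin 3), (∀ x, x = l ∨ ∃ j, g j = x) ∧
      G.Adj (g 0) (g 1) ∧ G.Adj (g 1) (g 2) ∧ G.Adj l (g p) := by
  have key : ∀ {W : Type} {H : SimpleGraph W}, Nonempty (G ≃g H) →
      (∀ l, H.IsLeafVertex l → ∃ (g : Fin 3 → W) (p : Fin 3), (∀ x, x = l ∨ ∃ j, g j = x) ∧
      H.Adj (g 0) (g 1) ∧ H.Adj (g 1) (g 2) ∧ H.Adj l (g p)) →
      ∃ (g : Fin 3 → V) (p : Fin 3), (∀ x, x = l ∨ ∃ j, g j = x) ∧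
      G.Adj (g 0) (g 1) ∧ G.Adj (g 1) (g 2) ∧ G.Adj l (g p) := by
    rintro W H ⟨φ⟩ h
    obtain ⟨g, p, h1, h2, h3, h4⟩ := h _ (φ.isLeafVertex hl)
    refine ⟨fun j => φ.symm (g j), p, fun x => ?_, φ.symm.map_adj_iff.2 h2,
      φ.symm.map_adj_iff.2 h3, ?_⟩
    · refine (h1 (φ x)).imp (fun h => φ.injective h) ?_
      rintro ⟨j, hj⟩
      exact ⟨j, by simp [hj]⟩
    · simpa using φ.symm.map_adj_iff.2 h4
  rcases hG with hG | hG
  · refine key hG fun l hl => ?_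
    rw [isLeafVertex_iff] at hl
    simp only [pathGraph_adj] at hl ⊢
    have : l = 0 ∨ l = 3 := by revert l; decide
    rcases this with rfl | rfl
    · exact ⟨![1, 2, 3], 0, by decide⟩
    · exact ⟨![0, 1, 2], 2, by decide⟩
  · refine key hG fun l hl => ?_
    rw [isLeafVertex_iff] at hl
    simp only [completeBipartiteGraph_adj] at hl ⊢
    have : l = .inr 0 ∨ l = .inr 1 ∨ l = .inr 2 := by revert l; decide
    rcases this with rfl | rfl | rfl
    · exact ⟨![.inr 1, .inl 0, .inr 2], 1, by decide⟩
    · exact ⟨![.inr 0, .inl 0, .inr 2], 1, by decide⟩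
    · exact ⟨![.inr 0, .inl 0, .inr 1], 1, by decide⟩

theorem IsTree.exists_iso_starTree_of_isSStar [Fintype V] {k : ℕ} (hG : G.IsTree)
    (hV : Fintype.card V = 3 * (k + 1) + 1) {F : Fin k → Σ n : ℕ, SimpleGraph (Fin n)}
    (hF : ∀ i, Nonempty ((F i).2 ≃g pathGraph 4) ∨
      Nonempty ((F i).2 ≃g completeBipartiteGraph (Fin 1) (Fin 3)))
    (h : G.IsSStar (Sum.elim ![⟨3, pathGraph 3⟩, ⟨2, pathGraph 2⟩] F)) :
    ∃ pos, Nonempty (starTree (0 : Fin (k + 1)) pos ≃g G) := by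
  obtain ⟨c, f, hleaf, -, hcov, -⟩ := h
  obtain ⟨g₀, h00, h01, h02, h0⟩ : ∃ g : Fin 3 → V, g 0 = c ∧ G.Adj (g 0) (g 1) ∧
      G.Adj (g 1) (g 2) ∧ ∀ x ∈ Set.range (f (.inl 0)), ∃ j, g j = x := by
    let φ : pathGraph 3 ↪g G := f (.inl 0)
    have ha : ∀ x y, G.Adj (φ x) (φ y) ↔ Consecutive x y := fun x y =>
      φ.map_adj_iff.trans pathGraph_adj
    obtain ⟨l, hl, hlc⟩ : ∃ l, (pathGraph 3).IsLeafVertex l ∧ φ l = c := hleaf (.inl 0)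
    have : l = 0 ∨ l = 2 := by
      rw [isLeafVertex_iff] at hl
      simp only [pathGraph_adj] at hl
      clear hlc
      revert l
      decide
    rcases this with rfl | rfl
    · exact ⟨φ, hlc, (ha _ _).2 (by decide), (ha _ _).2 (by decide), fun x hx => hx⟩
    · refine ⟨fun j => φ j.rev, hlc, (ha _ _).2 (by decide), (ha _ _).2 (by decide), ?_⟩
      rintro x ⟨y, rfl⟩
      exact ⟨Fin.rev y, congrArg φ (Fin.rev_rev y)⟩
  obtain ⟨v, hv, h1⟩ : ∃ v, G.Adj v c ∧ ∀ x ∈ Set.range (f (.inl 1)), x = v ∨ x = c := by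
    let φ : pathGraph 2 ↪g G := f (.inl 1)
    obtain ⟨l, -, rfl⟩ : ∃ l, (pathGraph 2).IsLeafVertex l ∧ φ l = c := hleaf (.inl 1)
    refine ⟨φ l.rev, φ.map_adj_iff.2 ?_, ?_⟩
    · have : ∀ l : Fin 2, l.rev.val + 1 = l.val ∨ l.val + 1 = l.rev.val := by decide
      exact pathGraph_adj.2 (this l)
    · rintro x ⟨y, rfl⟩
      have : ∀ y l : Fin 2, y = l.rev ∨ y = l := by decide
      exact (this y l).imp (congrArg φ) (congrArg φ)
  have h2 : ∀ i, ∃ (g : Fin 3 → V) (p : Fin 3), G.Adj (g 0) (g 1) ∧ G.Adj (g 1) (g 2) ∧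
      G.Adj c (g p) ∧ ∀ x ∈ Set.range (f (.inr i)), x = c ∨ ∃ j, g j = x := by
    intro i
    let φ : (F i).2 ↪g G := f (.inr i)
    obtain ⟨l, hl, rfl⟩ : ∃ l, (F i).2.IsLeafVertex l ∧ φ l = c := hleaf (.inr i)
    obtain ⟨g, p, hg, hg1, hg2, hg3⟩ := exists_path_of_isLeafVertex (hF i) hl
    refine ⟨fun j => φ (g j), p, φ.map_adj_iff.2 hg1, φ.map_adj_iff.2 hg2,
      φ.map_adj_iff.2 hg3, ?_⟩
    rintro x ⟨y, rfl⟩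
    refine (hg y).imp (congrArg φ) ?_
    rintro ⟨j, rfl⟩
    exact ⟨j, rfl⟩
  choose g p hg1 hg2 hgp hg using h2
  let q : Fin (k + 1) → Fin 3 → V := Fin.cons g₀ g
  let e : Option (Fin (k + 1) × Fin 3) → V := fun x => x.elim v fun y => q y.1 y.2
  have hsurj : Function.Surjective e := by
    have hc : ∃ x, e x = c := ⟨some (0, 0), h00⟩
    intro x
    obtain ⟨i | i, hi⟩ := hcov x
    · fin_cases i
      · obtain ⟨j, rfl⟩ := h0 x hi
        exact ⟨some (0, j), rfl⟩
      · rcases h1 x hi with rfl | rfl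
        · exact ⟨none, rfl⟩
        · exact hc
    · rcases hg i x hi with rfl | ⟨j, rfl⟩
      · exact hc
      · exact ⟨some (i.succ, j), rfl⟩
  -- The vertex count turns covering into bijectivity, so disjointness of the parts is automatic.
  have hbij : Function.Bijective e := by
    rw [Fintype.bijective_iff_surjective_and_card]
    exact ⟨hsurj, by simp [hV, mul_comm]⟩
  -- The value `0` at the distinguished index is arbitrary.
  refine ⟨Fin.cons 0 p, hG.nonempty_iso_starTree (Equiv.ofBijective e hbij) ?_ ?_ ?_ ?_⟩
  · change G.Adj v (g₀ 0)
    rwa [h00]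
  · exact Fin.cases h01 hg1
  · exact Fin.cases h02 hg2
  · refine Fin.cases (fun h => (h rfl).elim) fun i _ => ?_
    change G.Adj (g₀ 0) (g i (p i))
    rw [h00]
    exact hgp i

end SStar

end SimpleGraph

/-! ### The main theorem -/

open SimpleGraph in
theorem theorem4p3 (m : ℕ) (hm : 1 ≤ m) {V : Type*} [Fintype V]
    (hV : Fintype.card V = 3 * m + 1) :
    (∀ T : SimpleGraph V, T.IsTree → T.numMaximumDissociationSets ≤ 3 ^ (m - 1) + 1) ∧
    (∃ T : SimpleGraph V, T.IsTree ∧ T.numMaximumDissociationSets = 3 ^ (m - 1) + 1) ∧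
    (2 ≤ m → ∀ T : SimpleGraph V, T.IsTree →
      (T.numMaximumDissociationSets = 3 ^ (m - 1) + 1 ↔
        ∃ F : Fin (m - 1) → Σ n : ℕ, SimpleGraph (Fin n),
          (∀ i, Nonempty ((F i).2 ≃g SimpleGraph.pathGraph 4) ∨
            Nonempty ((F i).2 ≃g completeBipartiteGraph (Fin 1) (Fin 3))) ∧
          T.IsSStar (Sum.elim ![⟨3, SimpleGraph.pathGraph 3⟩, ⟨2, SimpleGraph.pathGraph 2⟩] F))) := by
  obtain ⟨k, rfl⟩ : ∃ k, m = k + 1 := ⟨m - 1, by omega⟩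
  have hnum : ∀ (i₀ : Fin (k + 1)) pos, (starTree i₀ pos).numMaximumDissociationSets =
      3 ^ (k + 1 - 1) + 1 := fun i₀ pos => by
    rw [numMaximumDissociationSets_starTree, Fintype.card_fin]
  refine ⟨fun T hT => ?_, ?_, fun _ T hT => ⟨fun h => ?_, ?_⟩⟩
  · by_contra! hlt
    obtain ⟨i₀, pos, ⟨φ⟩⟩ := hT.exists_iso_starTree hm hV (by omega)
    rw [← φ.numMaximumDissociationSets_eq, hnum] at hlt
    exact hlt.false
  · have e : Option (Fin (k + 1) × Fin 3) ≃ V :=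
      Fintype.equivOfCardEq (by simp [hV, mul_comm])
    let φ := Iso.map e (starTree 0 fun _ => 0)
    exact ⟨_, φ.isTree_iff.1 starTree_isTree, φ.numMaximumDissociationSets_eq ▸ hnum _ _⟩
  · obtain ⟨i₀, pos, ⟨φ⟩⟩ := hT.exists_iso_starTree hm hV (by omega)
    exact ⟨_, fun i => leafedPath_iso _, (starTree_isSStar i₀ pos).of_iso φ⟩
  · rintro ⟨F, hF, h⟩
    obtain ⟨pos, ⟨φ⟩⟩ := hT.exists_iso_starTree_of_isSStar hV hF h
    rw [← φ.numMaximumDissociationSets_eq, hnum]
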